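/- Let $\mathbb F$ be a field or skew field with an involution $a\mapsto\widetilde a$ (so $\widetilde{a+b}=\widetilde a+\widetilde b$, $\widetilde{ab}=\widetilde b\,\widetilde a$, $\widetilde{\widetilde a}=a$), possibly the identity if $\mathbb F$ is a field. For a matrix $A=[a_{ij}]$ over $\mathbb F$ put $A^*=[\widetilde a_{ji}]$. Square matrices $A,B$ are *congruent if $S^*AS=B$ for some nonsingular $S$; pencils $P,Q$ (matrices of the form $A+\lambda B$) are strictly equivalent if $SPR=Q$ for some nonsingular $S,R$ over $\mathbb F$. Let $X^{[p]}$ be the direct sum of $p$ copies of $X$, let $J_n$ be the $n\times n$ nilpotent Jordan block with ones on the first superdiagonal, and let $F_n=[I_{n-1}\;0]$ and $G_n=[0\;I_{n-1}]$, both of size $(n-1)\times n$. Zero-by-zero matrices are nonsingular. A regularizing decomposition of a pencil $P$ is a direct sum $(C+\lambda D)\oplus(M_1+\lambda N_1)\oplus\cdots\oplus(M_l+\lambda N_l)$ strictly equivalent to $P$ in which $C$ and $D$ are nonsingular square matrices and each $M_i+\lambda N_i$ is one of $I_n+\lambda J_n$, $J_n+\lambda I_n$, $F_n+\lambda G_n$,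 $G_n^T+\lambda F_n^T$ for some $n\ge1$; a pencil is *selfadjoint if it has the form $B+\lambda B^*$. **Theorem.** Let $A$ be a square matrix over $\mathbb F$. Suppose that $A$ is *congruent to $A_{(\tau)}\oplus M$, where $A_{(\tau)}$ is nonsingular and $$M=J_1^{[m_1-m_2]}\oplus J_2^{[m_2-m_3]}\oplus\cdots\oplus J_{2\tau-1}^{[m_{2\tau-1}-m_{2\tau}]}\oplus J_{2\tau}^{[m_{2\tau}]}$$ for some integers $\tau\ge 0$ and $m_1\ge m_2\ge\cdots\ge m_{2\tau}\ge0$. Then: 1. There is a nonsingular $S$ such that $S(A+\lambda A^*)S^*=(A_{(\tau)}+\lambda A_{(\tau)}^*)\oplus K$, where $$K=(J_1+\lambda J_1^T)^{[m_1-m_2]}\oplus(J_2+\lambda J_2^T)^{[m_2-m_3]}\oplus\cdots\oplus(J_{2\tau}+\lambda J_{2\tau}^T)^{[m_{2\tau}]},$$ and every $J_k+\lambda J_k^T$ is a *selfadjoint pencil. 2. If each direct summand $J_k+\lambda J_k^T$ of $K$ is replaced by $$\begin{cases}(F_\ell+\lambda G_\ell)\oplus(G_\ell^T+\lambda F_\ell^T)&\text{if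 }k=2\ell-1,\\(J_\ell+\lambda I_\ell)\oplus(I_\ell+\lambda J_\ell)&\text{if }k=2\ell,\end{cases}$$ the result is a regularizing decomposition of $A+\lambda A^*$, with the *selfadjoint regular part $A_{(\tau)}+\lambda A_{(\tau)}^*$. 3. For every $\ell\ge1$, $J_{2\ell-1}+\lambda J_{2\ell-1}^T$ is strictly equivalent to $(F_\ell+\lambda G_\ell)\oplus(G_\ell^T+\lambda F_\ell^T)$, and $J_{2\ell}+\lambda J_{2\ell}^T$ is strictly equivalent to $(J_\ell+\lambda I_\ell)\oplus(I_\ell+\lambda J_\ell)$. -/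

import Mathlib

open scoped Polynomial Matrix

namespace StarPencil

variable {F : Type*} [DivisionRing F]

/-- A matrix is nonsingular if it has a two-sided inverse. Rows and columns may be labelled by
different finite sets; over a division ring these then have the same number of elements. For
equal labels this is `IsUnit S`. A zero-by-zero matrix is nonsingular. -/
def IsNonsingular {m n : Type*} [Fintype m] [Fintype n] [DecidableEq m] [DecidableEq n]
    (S : Matrix m n F) : Prop :=
  ∃ T : Matrix n m F, S * T = 1 ∧ T * S = 1

/-- `A` and `B` are *congruent: `S* A S = B` for some nonsingular `S`. -/
def StarCongruent [StarRing F] {m n : Type*} [Fintype m] [Fintype n] [DecidableEq m]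
    [DecidableEq n] (A : Matrix m m F) (B : Matrix n n F) : Prop :=
  ∃ S : Matrix m n F, IsNonsingular S ∧ Sᴴ * A * S = B

/-- The matrix pencil `A + λ B`, a matrix over the ring `F[λ]` (in which `λ` is central). -/
noncomputable def pencil {m n : Type*} (A B : Matrix m n F) : Matrix m n F[X] :=
  A.map Polynomial.C + (Polynomial.X : F[X]) • B.map Polynomial.C

/-- Strict equivalence of matrix pencils: `S P R = Q` with `S`, `R` nonsingular over `F`. -/
def StrictlyEquivalent {m n m' n' : Type*} [Fintype m] [Fintype n] [Fintype m'] [Fintype n']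
    [DecidableEq m] [DecidableEq n] [DecidableEq m'] [DecidableEq n']
    (P : Matrix m n F[X]) (Q : Matrix m' n' F[X]) : Prop :=
  ∃ (S : Matrix m' m F) (R : Matrix n n' F), IsNonsingular S ∧ IsNonsingular R ∧
    S.map Polynomial.C * P * R.map Polynomial.C = Q

/-- A *selfadjoint pencil is one of the form `A + λ A*`. -/
def IsStarSelfadjointPencil [StarRing F] {n : Type*} (P : Matrix n n F[X]) : Prop :=
  ∃ A : Matrix n n F, P = pencil A Aᴴ

/-- The direct sum `A ⊕ B`. -/
def dsum {R : Type*} [Zero R] {m n m' n' : Type*} (A : Matrix m n R) (B : Matrix m' n' R) :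
    Matrix (m ⊕ m') (n ⊕ n') R :=
  Matrix.fromBlocks A 0 0 B

/-- The direct sum `A^[p] = A ⊕ ⋯ ⊕ A` of `p` copies of `A`. -/
def dpow {R : Type*} [Zero R] {m n : Type*} (A : Matrix m n R) (p : ℕ) :
    Matrix (m × Fin p) (n × Fin p) R :=
  Matrix.blockDiagonal fun _ : Fin p => A

variable (F) in
/-- The `n`-by-`n` singular Jordan block `J_n`, with ones on the first superdiagonal. -/
def jordanBlock (n : ℕ) : Matrix (Fin n) (Fin n) F :=
  Matrix.of fun i j => if (i : ℕ) + 1 = (j : ℕ) then 1 else 0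

variable (F) in
/-- The `(n-1)`-by-`n` matrix `F_n = [I 0]`. -/
def matF (n : ℕ) : Matrix (Fin (n - 1)) (Fin n) F :=
  Matrix.of fun i j => if (i : ℕ) = (j : ℕ) then 1 else 0

variable (F) in
/-- The `(n-1)`-by-`n` matrix `G_n = [0 I]`. -/
def matG (n : ℕ) : Matrix (Fin (n - 1)) (Fin n) F :=
  Matrix.of fun i j => if (i : ℕ) + 1 = (j : ℕ) then 1 else 0

/-- Names of the singular Kronecker summands: `IJ n` for `I_n + λ J_n`, `JI n` for `J_n + λ I_n`,
`FG n` for `F_n + λ G_n`, and `GF n` for `G_nᵀ + λ F_nᵀ`. -/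
inductive KroneckerBlock : Type
  | IJ (n : ℕ)
  | JI (n : ℕ)
  | FG (n : ℕ)
  | GF (n : ℕ)

namespace KroneckerBlock

/-- The index `n` of a block. -/
def index : KroneckerBlock → ℕ
  | IJ n => n
  | JI n => n
  | FG n => n
  | GF n => n

/-- The number of rows. -/
def rows : KroneckerBlock → ℕ
  | IJ n => n
  | JI n => n
  | FG n => n - 1
  | GF n => n

/-- The number of columns. -/
def cols : KroneckerBlock → ℕ
  | IJ n => n
  | JI n => n
  | FG n => n
  | GF n => n - 1

variable (F) in
/-- The pencil named by a block. -/
noncomputable def toPencil : (b : KroneckerBlock) → Matrix (Fin b.rows) (Fin b.cols) F[X]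
  | IJ n => pencil (1 : Matrix (Fin n) (Fin n) F) (jordanBlock F n)
  | JI n => pencil (jordanBlock F n) (1 : Matrix (Fin n) (Fin n) F)
  | FG n => pencil (matF F n) (matG F n)
  | GF n => pencil (matG F n)ᵀ (matF F n)ᵀ

end KroneckerBlock

/-- The direct sum of `C + λ D` and the family `s` of Kronecker summands (each of index at
least one) is a regularizing decomposition of the pencil `P`: it is strictly equivalent to `P`,
and the constituents `C`, `D` of the regular part are nonsingular. -/
def IsRegularizingDecomposition {m n r ι : Type*} [Fintype m] [Fintype n] [Fintype r]
    [Fintype ι] [DecidableEq m] [DecidableEq n] [DecidableEq r] [DecidableEq ι]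
    (P : Matrix m n F[X]) (C D : Matrix r r F) (s : ι → KroneckerBlock) : Prop :=
  IsNonsingular C ∧ IsNonsingular D ∧ (∀ q, 1 ≤ (s q).index) ∧
    StrictlyEquivalent P
      (dsum (pencil C D) (Matrix.blockDiagonal' fun q => (s q).toPencil F))

/-- The multiplicity of the summand of size `k` (`1 ≤ k ≤ 2τ`): `m_k - m_{k+1}` for `k < 2τ`,
and `m_{2τ}` for `k = 2τ`. -/
def mult (τ : ℕ) (m : ℕ → ℕ) (k : ℕ) : ℕ :=
  if k = 2 * τ then m k else m k - m (k + 1)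

/-- The labels of the rows and columns of `J_1^[m_1 - m_2] ⊕ J_2^[m_2 - m_3] ⊕ ⋯ ⊕ J_{2τ}^[m_{2τ}]`:
a summand `i` (of size `k = i + 1`), a position in the block, and the number of the copy. -/
abbrev SingularIndex (τ : ℕ) (m : ℕ → ℕ) : Type :=
  Σ i : Fin (2 * τ), Fin ((i : ℕ) + 1) × Fin (mult τ m ((i : ℕ) + 1))

variable (F) in
/-- `J_1^[m_1 - m_2] ⊕ J_2^[m_2 - m_3] ⊕ ⋯ ⊕ J_{2τ}^[m_{2τ}]`; the summand with index
`i : Fin (2τ)` belongs to the size `k = i + 1`. -/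
def singularPart (τ : ℕ) (m : ℕ → ℕ) : Matrix (SingularIndex τ m) (SingularIndex τ m) F :=
  Matrix.blockDiagonal' fun i : Fin (2 * τ) =>
    dpow (jordanBlock F ((i : ℕ) + 1)) (mult τ m ((i : ℕ) + 1))

variable (F) in
/-- `K = (J_1 + λ J_1ᵀ)^[m_1 - m_2] ⊕ (J_2 + λ J_2ᵀ)^[m_2 - m_3] ⊕ ⋯ ⊕
(J_{2τ} + λ J_{2τ}ᵀ)^[m_{2τ}]`, indexed like `singularPart`. -/
noncomputable def singularPencil (τ : ℕ) (m : ℕ → ℕ) :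
    Matrix (SingularIndex τ m) (SingularIndex τ m) F[X] :=
  Matrix.blockDiagonal' fun i : Fin (2 * τ) =>
    dpow (pencil (jordanBlock F ((i : ℕ) + 1)) (jordanBlock F ((i : ℕ) + 1))ᵀ)
      (mult τ m ((i : ℕ) + 1))

/-- The two Kronecker summands that replace `J_k + λ J_kᵀ`: `F_ℓ + λ G_ℓ` and `G_ℓᵀ + λ F_ℓᵀ`
if `k = 2ℓ - 1`, and `J_ℓ + λ I_ℓ` and `I_ℓ + λ J_ℓ` if `k = 2ℓ`. -/
def replacement (k : ℕ) : Fin 2 → KroneckerBlock :=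
  if Odd k then ![.FG ((k + 1) / 2), .GF ((k + 1) / 2)] else ![.JI (k / 2), .IJ (k / 2)]

/-- All Kronecker summands obtained from `singularPencil` when every one of the copies of each
`J_k + λ J_kᵀ` is replaced by its two Kronecker summands. -/
def replacedBlocks (τ : ℕ) (m : ℕ → ℕ) :
    (Σ i : Fin (2 * τ), Fin (mult τ m ((i : ℕ) + 1)) × Fin 2) → KroneckerBlock :=
  fun q => replacement ((q.1 : ℕ) + 1) q.2.2

end StarPencil

open StarPencil

/-! A *congruence `Sᴴ * A * S` acts on `A` and `Aᴴ` by the same pair of factors, so it carries `A +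
λ A*` to the pencil of the block sum (`map_C_mul_pencil_mul_map_C`). Everything else is permutation
of rows and columns. In `J_k + λ J_kᵀ` row `i` meets only columns `i + 1` (entry `1`) and `i - 1`
(entry `λ`), so rows of one parity meet only columns of the other. The pencil splits into two
staircases, which are the two Kronecker blocks once their rows and columns are suitably ordered
(`pencil_jordanBlock_odd_submatrix`, `pencil_jordanBlock_even_submatrix`). Permuting inside every
summand at once, by `blockDiagonal'_dpow_submatrix_regroup`, gives the regularizing decomposition.
-/

namespace StarPencil

/-! ### Nonsingular and permutation matrices -/

section Nonsingular

variable {F : Type*} [DivisionRing F] {l m n : Type*} [Fintype l] [Fintype m] [Fintype n]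
  [DecidableEq l] [DecidableEq m] [DecidableEq n]

theorem IsNonsingular.mul {S : Matrix l m F} {T : Matrix m n F} (hS : IsNonsingular S)
    (hT : IsNonsingular T) : IsNonsingular (S * T) := by
  obtain ⟨S', h₁, h₂⟩ := hS
  obtain ⟨T', h₃, h₄⟩ := hT
  refine ⟨T' * S', ?_, ?_⟩
  · rw [Matrix.mul_assoc, ← Matrix.mul_assoc T, h₃, Matrix.one_mul, h₁]
  · rw [Matrix.mul_assoc, ← Matrix.mul_assoc S', h₂, Matrix.one_mul, h₄]

theorem IsNonsingular.conjTranspose [StarRing F] {S : Matrix m n F} (hS : IsNonsingular S) :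
    IsNonsingular Sᴴ := by
  obtain ⟨T, h₁, h₂⟩ := hS
  refine ⟨Tᴴ, ?_, ?_⟩
  · rw [← Matrix.conjTranspose_mul, h₂, Matrix.conjTranspose_one]
  · rw [← Matrix.conjTranspose_mul, h₁, Matrix.conjTranspose_one]

theorem isNonsingular_one_submatrix_left (e : m ≃ n) :
    IsNonsingular ((1 : Matrix n n F).submatrix e id) := by
  refine ⟨(1 : Matrix n n F).submatrix id e, ?_, ?_⟩
  · ext i j
    simp [Matrix.mul_apply, Matrix.one_apply]
  · rw [Matrix.submatrix_mul_equiv, Matrix.one_mul, Matrix.submatrix_id_id]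

theorem isNonsingular_one_submatrix_right (e : m ≃ n) :
    IsNonsingular ((1 : Matrix n n F).submatrix id e) := by
  refine ⟨(1 : Matrix n n F).submatrix e id, ?_, ?_⟩
  · rw [Matrix.submatrix_mul_equiv, Matrix.one_mul, Matrix.submatrix_id_id]
  · ext i j
    simp [Matrix.mul_apply, Matrix.one_apply]

end Nonsingular

/-! ### Pencils under constant factors and direct sums -/

section Pencil

variable {F : Type*} [DivisionRing F] {l m n o : Type*}

theorem map_C_mul_pencil_mul_map_C [Fintype m] [Fintype n] (S : Matrix l m F)
    (A B : Matrix m n F) (R : Matrix n o F) :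
    S.map Polynomial.C * pencil A B * R.map Polynomial.C = pencil (S * A * R) (S * B * R) := by
  -- `F[λ]` need not be commutative; only the centrality of `λ` lets it pass `S`.
  have hX : S.map Polynomial.C * ((Polynomial.X : F[X]) • B.map Polynomial.C) =
      (Polynomial.X : F[X]) • (S.map Polynomial.C * B.map Polynomial.C) := by
    refine Matrix.ext fun i j => ?_
    simp only [Matrix.mul_apply, Matrix.smul_apply, smul_eq_mul, Finset.mul_sum]
    exact Finset.sum_congr rfl fun x _ => by rw [← mul_assoc, ← mul_assoc, Polynomial.X_mul]
  simp only [pencil, Matrix.map_mul, Matrix.mul_add, Matrix.add_mul, hX, Matrix.smul_mul]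

theorem pencil_apply (A B : Matrix m n F) (i : m) (j : n) :
    pencil A B i j = Polynomial.C (A i j) + Polynomial.X * Polynomial.C (B i j) := rfl

theorem pencil_dsum {m' n' : Type*} (A B : Matrix m n F) (A' B' : Matrix m' n' F) :
    pencil (dsum A A') (dsum B B') = dsum (pencil A B) (pencil A' B') := by
  refine Matrix.ext fun i j => ?_
  rcases i with i | i <;> rcases j with j | j <;> simp [pencil_apply, dsum]

theorem conjTranspose_dsum [StarRing F] {m' n' : Type*} (A : Matrix m n F)
    (B : Matrix m' n' F) : (dsum A B)ᴴ = dsum Aᴴ Bᴴ := by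
  simp [dsum, Matrix.fromBlocks_conjTranspose]

/-- The involution fixes the entries `0` and `1`. -/
theorem conjTranspose_jordanBlock [StarRing F] (k : ℕ) :
    (jordanBlock F k)ᴴ = (jordanBlock F k)ᵀ := by
  ext i j
  simp [jordanBlock, apply_ite (star : F → F)]

theorem pencil_singularPart_conjTranspose [StarRing F] (τ : ℕ) (μ : ℕ → ℕ) :
    pencil (singularPart F τ μ) (singularPart F τ μ)ᴴ = singularPencil F τ μ := by
  refine Matrix.ext fun ⟨i, p, c⟩ ⟨j, q, d⟩ => ?_
  simp only [singularPart, singularPencil, pencil_apply, Matrix.conjTranspose_apply]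
  by_cases hij : i = j
  · subst hij
    simp only [Matrix.blockDiagonal'_apply_eq, dpow, Matrix.blockDiagonal_apply]
    by_cases hcd : c = d
    · subst hcd
      simp only [if_true, pencil_apply, ← conjTranspose_jordanBlock, Matrix.conjTranspose_apply]
    · simp [hcd, Ne.symm hcd]
  · simp [Matrix.blockDiagonal'_apply_ne _ _ _ hij, Matrix.blockDiagonal'_apply_ne _ _ _ (Ne.symm hij)]

theorem isStarSelfadjointPencil_jordanBlock [StarRing F] (k : ℕ) :
    IsStarSelfadjointPencil (pencil (jordanBlock F k) (jordanBlock F k)ᵀ) :=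
  ⟨jordanBlock F k, by rw [conjTranspose_jordanBlock]⟩

end Pencil

/-! ### Strict equivalence -/

section StrictEquivalence

variable {F : Type*} [DivisionRing F] {m n m' n' m'' n'' : Type*}
  [Fintype m] [Fintype n] [Fintype m'] [Fintype n'] [Fintype m''] [Fintype n'']
  [DecidableEq m] [DecidableEq n] [DecidableEq m'] [DecidableEq n'] [DecidableEq m'']
  [DecidableEq n'']

theorem StrictlyEquivalent.trans {P : Matrix m n F[X]} {Q : Matrix m' n' F[X]}
    {T : Matrix m'' n'' F[X]} (h₁ : StrictlyEquivalent P Q) (h₂ : StrictlyEquivalent Q T) :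
    StrictlyEquivalent P T := by
  obtain ⟨S, R, hS, hR, rfl⟩ := h₁
  obtain ⟨S', R', hS', hR', rfl⟩ := h₂
  exact ⟨S' * S, R * R', hS'.mul hS, hR.mul hR', by simp only [Matrix.map_mul, Matrix.mul_assoc]⟩

/-- Relabelling is multiplication by permutation matrices; rows and columns may be permuted
independently. -/
theorem strictlyEquivalent_submatrix (P : Matrix m n F[X]) (e : m' ≃ m) (f : n' ≃ n) :
    StrictlyEquivalent P (P.submatrix e f) := by
  refine ⟨(1 : Matrix m m F).submatrix e id, (1 : Matrix n n F).submatrix id f,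
    isNonsingular_one_submatrix_left e, isNonsingular_one_submatrix_right f, ?_⟩
  refine Matrix.ext fun i j => ?_
  simp [Matrix.mul_apply, Matrix.one_apply, apply_ite (Polynomial.C : F → F[X])]

end StrictEquivalence

/-! ### Parity splitting of `J_k + λ J_kᵀ` -/

section JordanPencil

/-- The positions `1, 3, 5, …` and `0, 2, 4, …` of an odd number of indices, each in decreasing
order. -/
noncomputable def oddSplit (ℓ : ℕ) (hℓ : 1 ≤ ℓ) :
    Fin (ℓ - 1) ⊕ Fin ℓ ≃ Fin (2 * ℓ - 1) :=
  Equiv.ofBijective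
    (Sum.elim (fun i => ⟨2 * (ℓ - 2 - i) + 1, by omega⟩) (fun i => ⟨2 * (ℓ - 1 - i), by omega⟩))
    ((Fintype.bijective_iff_injective_and_card _).2 ⟨by
      rintro (i | i) (j | j) h <;> simp [Fin.ext_iff] at h ⊢ <;> omega, by
      simp; omega⟩)

/-- The positions `1, 3, 5, …` in increasing order and `0, 2, 4, …` in decreasing order of an even
number of indices. -/
noncomputable def evenSplitRows (ℓ : ℕ) : Fin ℓ ⊕ Fin ℓ ≃ Fin (2 * ℓ) :=
  Equiv.ofBijective
    (Sum.elim (fun i => ⟨2 * i + 1, by omega⟩) (fun i => ⟨2 * (ℓ - 1 - i), by omega⟩))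
    ((Fintype.bijective_iff_injective_and_card _).2 ⟨by
      rintro (i | i) (j | j) h <;> simp [Fin.ext_iff] at h ⊢ <;> omega, by
      simp; omega⟩)

/-- The positions `0, 2, 4, …` in increasing order and `1, 3, 5, …` in decreasing order of an even
number of indices. -/
noncomputable def evenSplitCols (ℓ : ℕ) : Fin ℓ ⊕ Fin ℓ ≃ Fin (2 * ℓ) :=
  Equiv.ofBijective
    (Sum.elim (fun i => ⟨2 * i, by omega⟩) (fun i => ⟨2 * (ℓ - 1 - i) + 1, by omega⟩))
    ((Fintype.bijective_iff_injective_and_card _).2 ⟨by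
      rintro (i | i) (j | j) h <;> simp [Fin.ext_iff] at h ⊢ <;> omega, by
      simp; omega⟩)

variable (F : Type*) [DivisionRing F]

/-- With entries `0` and `1`, comparing pencils reduces to comparing index conditions, which are
linear arithmetic. -/
theorem pencil_ite_apply {m n : Type*} {A B : Matrix m n F} {i : m} {j : n} {p q : Prop}
    [Decidable p] [Decidable q] (hA : A i j = if p then 1 else 0)
    (hB : B i j = if q then 1 else 0) :
    pencil A B i j = (if p then 1 else 0) + if q then Polynomial.X else 0 := by
  rw [pencil_apply, hA, hB]
  split_ifs <;> simp

theorem pencil_jordanBlock_transpose_apply {k : ℕ} (i j : Fin k) :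
    pencil (jordanBlock F k) (jordanBlock F k)ᵀ i j =
      (if (i : ℕ) + 1 = j then 1 else 0) + if (j : ℕ) + 1 = i then Polynomial.X else 0 :=
  pencil_ite_apply F rfl rfl

theorem pencil_jordanBlock_one_apply {k : ℕ} (i j : Fin k) :
    pencil (jordanBlock F k) 1 i j =
      (if (i : ℕ) + 1 = j then 1 else 0) + if (i : ℕ) = j then Polynomial.X else 0 :=
  pencil_ite_apply F rfl (by simp [Matrix.one_apply, Fin.ext_iff])

theorem pencil_one_jordanBlock_apply {k : ℕ} (i j : Fin k) :
    pencil 1 (jordanBlock F k) i j =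
      (if (i : ℕ) = j then 1 else 0) + if (i : ℕ) + 1 = j then Polynomial.X else 0 :=
  pencil_ite_apply F (by simp [Matrix.one_apply, Fin.ext_iff]) rfl

theorem pencil_matF_matG_apply {k : ℕ} (i : Fin (k - 1)) (j : Fin k) :
    pencil (matF F k) (matG F k) i j =
      (if (i : ℕ) = j then 1 else 0) + if (i : ℕ) + 1 = j then Polynomial.X else 0 :=
  pencil_ite_apply F rfl rfl

theorem pencil_matG_matF_transpose_apply {k : ℕ} (i : Fin k) (j : Fin (k - 1)) :
    pencil (matG F k)ᵀ (matF F k)ᵀ i j =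
      (if (j : ℕ) + 1 = i then 1 else 0) + if (j : ℕ) = i then Polynomial.X else 0 :=
  pencil_ite_apply F rfl rfl

/-- Decreasing order puts each `λ` to the right of the `1` in its row, as in `F_ℓ + λ G_ℓ`. The swap
on columns pairs odd rows with even columns and conversely. -/
theorem pencil_jordanBlock_odd_submatrix (ℓ : ℕ) (hℓ : 1 ≤ ℓ) :
    (pencil (jordanBlock F (2 * ℓ - 1)) (jordanBlock F (2 * ℓ - 1))ᵀ).submatrix
        (oddSplit ℓ hℓ) ((Equiv.sumComm _ _).trans (oddSplit ℓ hℓ)) =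
      dsum (pencil (matF F ℓ) (matG F ℓ)) (pencil (matG F ℓ)ᵀ (matF F ℓ)ᵀ) := by
  refine Matrix.ext fun i j => ?_
  rcases i with i | i <;> rcases j with j | j <;>
    simp only [Matrix.submatrix_apply, pencil_jordanBlock_transpose_apply, dsum,
      Matrix.fromBlocks_apply₁₁, Matrix.fromBlocks_apply₁₂, Matrix.fromBlocks_apply₂₁,
      Matrix.fromBlocks_apply₂₂, pencil_matF_matG_apply, pencil_matG_matF_transpose_apply,
      oddSplit, Equiv.ofBijective_apply, Equiv.trans_apply, Equiv.sumComm_apply, Sum.swap_inl,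
      Sum.swap_inr, Sum.elim_inl, Sum.elim_inr, Matrix.zero_apply]
  · congr 2 <;> apply propext <;> omega
  -- Row and column have equal parity here, so they cannot differ by one.
  · rw [if_neg (by omega), if_neg (by omega), add_zero]
  · rw [if_neg (by omega), if_neg (by omega), add_zero]
  · congr 2 <;> apply propext <;> omega

/-- Odd rows with even columns, both increasing, have `λ` on the diagonal and `1` above it. For even
rows with odd columns the order is reversed, which moves `λ` from below the diagonal to above it. -/
theorem pencil_jordanBlock_even_submatrix (ℓ : ℕ) :
    (pencil (jordanBlock F (2 * ℓ)) (jordanBlock F (2 * ℓ))ᵀ).submatrix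
        (evenSplitRows ℓ) (evenSplitCols ℓ) =
      dsum (pencil (jordanBlock F ℓ) 1) (pencil 1 (jordanBlock F ℓ)) := by
  refine Matrix.ext fun i j => ?_
  rcases i with i | i <;> rcases j with j | j <;>
    simp only [Matrix.submatrix_apply, pencil_jordanBlock_transpose_apply, dsum,
      Matrix.fromBlocks_apply₁₁, Matrix.fromBlocks_apply₁₂, Matrix.fromBlocks_apply₂₁,
      Matrix.fromBlocks_apply₂₂, pencil_jordanBlock_one_apply, pencil_one_jordanBlock_apply,
      evenSplitRows, evenSplitCols, Equiv.ofBijective_apply, Sum.elim_inl, Sum.elim_inr,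
      Matrix.zero_apply]
  · congr 2 <;> apply propext <;> omega
  · rw [if_neg (by omega), if_neg (by omega), add_zero]
  · rw [if_neg (by omega), if_neg (by omega), add_zero]
  · congr 2 <;> apply propext <;> omega

end JordanPencil

/-! ### Replacing all summands simultaneously -/

section Replacement

/-- A disjoint union over a two-element family, as a sum type. -/
def sigmaFinTwoEquiv {α : Type*} (f : α → Type*) (a b : α) :
    (Σ t : Fin 2, f (![a, b] t)) ≃ f a ⊕ f b where
  toFun
    | ⟨0, x⟩ => Sum.inl x
    | ⟨1, x⟩ => Sum.inr x
  invFun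
    | Sum.inl x => ⟨0, x⟩
    | Sum.inr x => ⟨1, x⟩
  left_inv := by rintro ⟨t, x⟩; fin_cases t <;> rfl
  right_inv := by rintro (x | x) <;> rfl

variable (F : Type*) [DivisionRing F]

theorem dsum_toPencil_submatrix (a b : KroneckerBlock) :
    (dsum (a.toPencil F) (b.toPencil F)).submatrix
        (sigmaFinTwoEquiv (fun c => Fin c.rows) a b)
        (sigmaFinTwoEquiv (fun c => Fin c.cols) a b) =
      Matrix.blockDiagonal' fun t : Fin 2 => (![a, b] t).toPencil F := by
  refine Matrix.ext fun ⟨s, x⟩ ⟨t, y⟩ => ?_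
  fin_cases s <;> fin_cases t
  · exact (Matrix.blockDiagonal'_apply_eq
      (fun t : Fin 2 => (![a, b] t).toPencil F) 0 x y).symm
  · exact (Matrix.blockDiagonal'_apply_ne
      (fun t : Fin 2 => (![a, b] t).toPencil F) x y zero_ne_one).symm
  · exact (Matrix.blockDiagonal'_apply_ne
      (fun t : Fin 2 => (![a, b] t).toPencil F) x y one_ne_zero).symm
  · exact (Matrix.blockDiagonal'_apply_eq
      (fun t : Fin 2 => (![a, b] t).toPencil F) 1 x y).symm

theorem exists_pencil_jordanBlock_submatrix_eq_replacement (k : ℕ) :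
    ∃ (e : (Σ t : Fin 2, Fin (replacement k t).rows) ≃ Fin k)
      (f : (Σ t : Fin 2, Fin (replacement k t).cols) ≃ Fin k),
      (pencil (jordanBlock F k) (jordanBlock F k)ᵀ).submatrix e f =
        Matrix.blockDiagonal' fun t : Fin 2 => (replacement k t).toPencil F := by
  rcases Nat.even_or_odd' k with ⟨ℓ, rfl | rfl⟩
  · have h : replacement (2 * ℓ) = ![.JI ℓ, .IJ ℓ] := by
      simp [replacement]
    rw [h]
    refine ⟨(sigmaFinTwoEquiv (fun c : KroneckerBlock => Fin c.rows) _ _).trans (evenSplitRows ℓ),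
      (sigmaFinTwoEquiv (fun c : KroneckerBlock => Fin c.cols) _ _).trans (evenSplitCols ℓ), ?_⟩
    rw [← dsum_toPencil_submatrix]
    exact congrArg (fun M => Matrix.submatrix M _ _) (pencil_jordanBlock_even_submatrix F ℓ)
  · have h : replacement (2 * ℓ + 1) = ![.FG (ℓ + 1), .GF (ℓ + 1)] := by
      have h₁ : Odd (2 * ℓ + 1) := ⟨ℓ, rfl⟩
      have h₂ : (2 * ℓ + 1 + 1) / 2 = ℓ + 1 := by omega
      rw [replacement, if_pos h₁, h₂]
    rw [h]
    -- `2 * (ℓ + 1) - 1` is definitionally `2 * ℓ + 1`, so no cast is needed.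
    refine ⟨(sigmaFinTwoEquiv (fun c : KroneckerBlock => Fin c.rows) _ _).trans
        (oddSplit (ℓ + 1) (Nat.le_add_left 1 ℓ)),
      (sigmaFinTwoEquiv (fun c : KroneckerBlock => Fin c.cols) _ _).trans
        ((Equiv.sumComm _ _).trans (oddSplit (ℓ + 1) (Nat.le_add_left 1 ℓ))), ?_⟩
    rw [← dsum_toPencil_submatrix]
    exact congrArg (fun M => Matrix.submatrix M _ _)
      (pencil_jordanBlock_odd_submatrix F (ℓ + 1) (Nat.le_add_left 1 ℓ))

/-- Regrouping of the labels of a direct sum of multiples of direct sums. -/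
def regroup {ι κ : Type*} {α : ι → Type*} {β : ι → κ → Type*} {γ : ι → Type*}
    (e : ∀ i, (Σ t, β i t) ≃ γ i) :
    (Σ q : (Σ i, α i × κ), β q.1 q.2.2) ≃ Σ i, γ i × α i where
  toFun x := ⟨x.1.1, e x.1.1 ⟨x.1.2.2, x.2⟩, x.1.2.1⟩
  invFun y := ⟨⟨y.1, y.2.2, ((e y.1).symm y.2.1).1⟩, ((e y.1).symm y.2.1).2⟩
  left_inv := by
    rintro ⟨⟨i, a, t⟩, x⟩
    dsimp only
    rw [Equiv.symm_apply_apply]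
  right_inv := by
    rintro ⟨i, c, a⟩
    simp

/-- Splittings of the individual summands assemble into one of the whole sum: entries between
different summands or copies vanish on both sides, and within one copy `h` applies. -/
theorem blockDiagonal'_dpow_submatrix_regroup {R ι κ : Type*} [Zero R] [DecidableEq ι]
    [DecidableEq κ] {p : ι → ℕ} {β β' : ι → κ → Type*} {γ γ' : ι → Type*}
    (P : ∀ i, Matrix (γ i) (γ' i) R) (N : ∀ i t, Matrix (β i t) (β' i t) R)
    (e : ∀ i, (Σ t, β i t) ≃ γ i) (f : ∀ i, (Σ t, β' i t) ≃ γ' i)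
    (h : ∀ i, (P i).submatrix (e i) (f i) = Matrix.blockDiagonal' (N i)) :
    (Matrix.blockDiagonal' fun i => dpow (P i) (p i)).submatrix
        (regroup (α := fun i => Fin (p i)) e) (regroup (α := fun i => Fin (p i)) f) =
      Matrix.blockDiagonal' fun q : (Σ i, Fin (p i) × κ) => N q.1 q.2.2 := by
  refine Matrix.ext fun ⟨⟨i, a, s⟩, x⟩ ⟨⟨j, b, t⟩, y⟩ => ?_
  simp only [Matrix.submatrix_apply, regroup, Equiv.coe_fn_mk]
  by_cases hij : i = j
  · subst hij
    rw [Matrix.blockDiagonal'_apply_eq, dpow, Matrix.blockDiagonal_apply]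
    by_cases hab : a = b
    · subst hab
      have hx := congrFun (congrFun (h i) ⟨s, x⟩) ⟨t, y⟩
      rw [Matrix.submatrix_apply] at hx
      rw [if_pos rfl, hx]
      by_cases hst : s = t
      · subst hst
        rw [Matrix.blockDiagonal'_apply_eq]
        exact (Matrix.blockDiagonal'_apply_eq
          (fun q : (Σ i, Fin (p i) × κ) => N q.1 q.2.2) ⟨i, a, s⟩ x y).symm
      · rw [Matrix.blockDiagonal'_apply_ne _ _ _ hst,
          Matrix.blockDiagonal'_apply_ne _ _ _ (by simpa using hst)]
    · rw [if_neg hab, Matrix.blockDiagonal'_apply_ne _ _ _ (by simp [hab])]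
  · rw [Matrix.blockDiagonal'_apply_ne _ _ _ hij, Matrix.blockDiagonal'_apply_ne]
    exact fun hq => hij (congrArg Sigma.fst hq)

theorem one_le_index_replacedBlocks (τ : ℕ) (μ : ℕ → ℕ)
    (q : Σ i : Fin (2 * τ), Fin (mult τ μ ((i : ℕ) + 1)) × Fin 2) :
    1 ≤ (replacedBlocks τ μ q).index := by
  obtain ⟨i, c, t⟩ := q
  simp only [replacedBlocks, replacement]
  split_ifs with h
  · fin_cases t <;> simp [KroneckerBlock.index] <;> omega
  -- An even size `i + 1` is positive, hence at least two.
  · have h' : 1 ≤ ((i : ℕ) + 1) / 2 := by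
      rw [Nat.not_odd_iff_even] at h
      obtain ⟨a, ha⟩ := h
      omega
    fin_cases t <;> simpa [KroneckerBlock.index] using h'

theorem exists_singularPencil_submatrix_eq_replacedBlocks (τ : ℕ) (μ : ℕ → ℕ) :
    ∃ (e : (Σ q, Fin (replacedBlocks τ μ q).rows) ≃ SingularIndex τ μ)
      (f : (Σ q, Fin (replacedBlocks τ μ q).cols) ≃ SingularIndex τ μ),
      (singularPencil F τ μ).submatrix e f =
        Matrix.blockDiagonal' fun q => (replacedBlocks τ μ q).toPencil F := by
  choose e f h using exists_pencil_jordanBlock_submatrix_eq_replacement F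
  exact ⟨regroup fun i : Fin (2 * τ) => e ((i : ℕ) + 1),
    regroup fun i : Fin (2 * τ) => f ((i : ℕ) + 1),
    blockDiagonal'_dpow_submatrix_regroup (p := fun i : Fin (2 * τ) => mult τ μ ((i : ℕ) + 1))
      (fun i : Fin (2 * τ) => pencil (jordanBlock F ((i : ℕ) + 1)) (jordanBlock F ((i : ℕ) + 1))ᵀ)
      (fun i t => (replacement ((i : ℕ) + 1) t).toPencil F) _ _ fun i => h ((i : ℕ) + 1)⟩

theorem dsum_submatrix_sumCongr {R : Type*} [Zero R] {l k m n m' n' : Type*} (A : Matrix l k R)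
    (B : Matrix m n R) (e : m' ≃ m) (f : n' ≃ n) :
    (dsum A B).submatrix ((Equiv.refl l).sumCongr e) ((Equiv.refl k).sumCongr f) =
      dsum A (B.submatrix e f) := by
  refine Matrix.ext fun i j => ?_
  rcases i with i | i <;> rcases j with j | j <;> rfl

end Replacement

end StarPencil

theorem mainTheorem4 {F : Type*} [DivisionRing F] [StarRing F] {n r : ℕ}
    (A : Matrix (Fin n) (Fin n) F) (Aτ : Matrix (Fin r) (Fin r) F) (τ : ℕ) (m : ℕ → ℕ)
    (hm : AntitoneOn m (Set.Icc 1 (2 * τ))) (hAτ : IsNonsingular Aτ)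
    (hA : StarCongruent A (dsum Aτ (singularPart F τ m))) :
    (∃ S : Matrix (Fin r ⊕ SingularIndex τ m) (Fin n) F, IsNonsingular S ∧
      S.map Polynomial.C * pencil A Aᴴ * Sᴴ.map Polynomial.C =
        dsum (pencil Aτ Aτᴴ) (singularPencil F τ m)) ∧
    (∀ k : ℕ, IsStarSelfadjointPencil (pencil (jordanBlock F k) (jordanBlock F k)ᵀ)) ∧
    IsRegularizingDecomposition (pencil A Aᴴ) Aτ Aτᴴ (replacedBlocks τ m) ∧
    (∀ ℓ : ℕ, 1 ≤ ℓ →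
      StrictlyEquivalent
        (pencil (jordanBlock F (2 * ℓ - 1)) (jordanBlock F (2 * ℓ - 1))ᵀ)
        (dsum (pencil (matF F ℓ) (matG F ℓ)) (pencil (matG F ℓ)ᵀ (matF F ℓ)ᵀ))) ∧
    (∀ ℓ : ℕ, 1 ≤ ℓ →
      StrictlyEquivalent
        (pencil (jordanBlock F (2 * ℓ)) (jordanBlock F (2 * ℓ))ᵀ)
        (dsum (pencil (jordanBlock F ℓ) 1) (pencil 1 (jordanBlock F ℓ)))) := by
  obtain ⟨S, hS, hSA⟩ := hA
  have hpencil : Sᴴ.map Polynomial.C * pencil A Aᴴ * S.map Polynomial.C =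
      dsum (pencil Aτ Aτᴴ) (singularPencil F τ m) := by
    have hSA' : Sᴴ * Aᴴ * S = (Sᴴ * A * S)ᴴ := by
      simp only [Matrix.conjTranspose_mul, Matrix.conjTranspose_conjTranspose, Matrix.mul_assoc]
    rw [map_C_mul_pencil_mul_map_C, hSA', hSA, conjTranspose_dsum, pencil_dsum,
      pencil_singularPart_conjTranspose]
  -- The witness is `Sᴴ`, since *congruence is `S* A S` but the claim is about `S (A + λ A*) S*`.
  refine ⟨⟨Sᴴ, hS.conjTranspose, by rwa [Matrix.conjTranspose_conjTranspose]⟩,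
    isStarSelfadjointPencil_jordanBlock,
    ⟨hAτ, hAτ.conjTranspose, one_le_index_replacedBlocks τ m, ?_⟩, fun ℓ hℓ => ?_, fun ℓ _ => ?_⟩
  · obtain ⟨e, f, hef⟩ := exists_singularPencil_submatrix_eq_replacedBlocks F τ m
    rw [← hef, ← dsum_submatrix_sumCongr]
    exact StrictlyEquivalent.trans ⟨Sᴴ, S, hS.conjTranspose, hS, hpencil⟩
      (strictlyEquivalent_submatrix _ _ _)
  · rw [← pencil_jordanBlock_odd_submatrix F ℓ hℓ]
    exact strictlyEquivalent_submatrix _ _ _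
  · rw [← pencil_jordanBlock_even_submatrix F ℓ]
    exact strictlyEquivalent_submatrix _ _ _
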